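/- Work in the polynomial ring $\mathbb{Z}[q,x]$ in the variables $x_1,x_2,\ldots$ and $q_1,q_2,\ldots$, graded by $\deg x_i=1$, $\deg q_i=2$; the lowest homogeneous component of a nonzero polynomial is its nonzero homogeneous component of smallest degree. For $0\le p\le k$ let $e_p^k=e_p(x_1,\ldots,x_k)$ be the elementary symmetric polynomial; let the quantum elementary polynomial $E_p^k$ be the coefficient of $\lambda^p$ in $\det(1+\lambda\Gamma_k)$, where $\Gamma_k$ is the tridiagonal $k\times k$ matrix with diagonal $x_1,\ldots,x_k$, superdiagonal $q_1,\ldots,q_{k-1}$ and all subdiagonal entries $-1$; and let $$F_p^k=\sum_{I\subseteq\{1,\ldots,k\},\,|I|=p}\ \prod_{i\in I}(1-x_i)\prod_{i\in I,\ i+1\notin I}(1-q_i),\qquad \widehat E_p^k=\sum_{i=0}^p(-1)^i\binom{k-i}{p-i}F_i^k .$$ For $n\ge 0$ let $L_n$ be the $\mathbb{Z}$-span of the monomials $x_1^{i_1}\cdots x_{n-1}^{i_{n-1}}$ with $0\le i_j\le n-j$. The products $e_{p_1}^1\cdots e_{p_{n-1}}^{n-1}$ with $0\le p_k\le k$ form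 a $\mathbb{Z}$-basis of $L_n$. Let $Q$ and $\widehat Q$ be the $\mathbb{Z}[q]$-linear maps from $L_n^q=\mathbb{Z}[q]\otimes L_n$ to $\mathbb{Z}[q,x]$ such that for all $0\le p_k\le k$ $$Q(e_{p_1}^1\cdots e_{p_{n-1}}^{n-1})=E_{p_1}^1\cdots E_{p_{n-1}}^{n-1},\qquad \widehat Q(e_{p_1}^1\cdots e_{p_{n-1}}^{n-1})=\widehat E_{p_1}^1\cdots\widehat E_{p_{n-1}}^{n-1}.$$ For $w\in S_n$, let $w_\circ$ be the longest element of $S_n$ and $s_{i_1}\cdots s_{i_l}$ a reduced word of $w^{-1}w_\circ$. The Schubert and Grothendieck polynomials are $$\mathfrak S_w=\partial_{i_1}\cdots\partial_{i_l}(x_1^{n-1}x_2^{n-2}\cdots x_{n-1}),\qquad \mathfrak G_w=\pi_{i_1}\cdots\pi_{i_l}(x_1^{n-1}x_2^{n-2}\cdots x_{n-1}),$$ where $\partial_i=(1-s_i)/(x_i-x_{i+1})$ and $\pi_i=1+(1-x_i)\partial_i$, with $s_i$ acting on polynomials by exchanging $x_i$ and $x_{i+1}$; both lie in $L_n$. The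 quantum Schubert polynomial is $\mathfrak S_w^q=Q(\mathfrak S_w)$ and the quantum Grothendieck polynomial is $\mathfrak G_w^q=\widehat Q(\mathfrak G_w)$. **Proposition.** (1) For all $0\le p\le k$, the lowest homogeneous component of $\widehat E_p^k$ is $E_p^k$, and the specialization of $\widehat E_p^k$ at $q_1=q_2=\cdots=0$ is $e_p^k$. (2) For all $n$ and all $w\in S_n$, the lowest homogeneous component of $\mathfrak G_w^q$ is $\mathfrak S_w^q$, and the specialization of $\mathfrak G_w^q$ at $q_1=q_2=\cdots=0$ is $\mathfrak G_w$. -/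

import Mathlib

open MvPolynomial

namespace QGroth

noncomputable section

/-! Variables are indexed from `0`: `X j` stands for the variable `x_{j+1}`, and the `j`-th
variable of `ℤ[q]` stands for `q_{j+1}`. -/

/-- `ℤ[q] = ℤ[q_1, q_2, …]`. -/
abbrev Zq : Type := MvPolynomial ℕ ℤ

/-- `ℤ[x] = ℤ[x_1, x_2, …]`. -/
abbrev Zx : Type := MvPolynomial ℕ ℤ

/-- `ℤ[q, x]`, as the ring of polynomials in the variables `x` over `ℤ[q]`. -/
abbrev Zqx : Type := MvPolynomial ℕ Zq

/-- The variable `x_{j+1}` of `ℤ[q, x]`. -/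
def xv (j : ℕ) : Zqx := X j

/-- The variable `q_{j+1}` of `ℤ[q, x]`. -/
def qv (j : ℕ) : Zqx := C (X j)

/-- The inclusion `ℤ[x] → ℤ[q, x]`. -/
def inclX : Zx →+* Zqx := map (C : ℤ →+* Zq)

/-- The specialization `ℤ[q, x] → ℤ[x]` at `q_1 = q_2 = … = 0`. -/
def specQ : Zqx →+* Zx := map (constantCoeff : Zq →+* ℤ)

/-! ### The grading `deg x_i = 1`, `deg q_i = 2` -/

/-- The homogeneous component of degree `d` for the grading `deg x_i = 1`, `deg q_i = 2`
(the left summand of `ℕ ⊕ ℕ` indexes the variables `x`, the right one the variables `q`). -/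
def homComponent (d : ℕ) (f : Zqx) : Zqx :=
  sumAlgEquiv ℤ ℕ ℕ (weightedHomogeneousComponent (Sum.elim (fun _ => 1) (fun _ => 2) : ℕ ⊕ ℕ → ℕ) d
    ((sumAlgEquiv ℤ ℕ ℕ).symm f))

/-- `g` is the lowest (nonzero) homogeneous component of `f`. -/
def IsLowestComponent (f g : Zqx) : Prop :=
  g ≠ 0 ∧ ∃ d : ℕ, homComponent d f = g ∧ ∀ m < d, homComponent m f = 0

/-! ### Elementary symmetric polynomials and their two quantum versions -/

/-- `e_p^k = e_p(x_1, …, x_k)`. -/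
def elem (R : Type*) [CommRing R] (p k : ℕ) : MvPolynomial ℕ R :=
  ((Finset.range k).val.map (X : ℕ → MvPolynomial ℕ R)).esymm p

/-- The tridiagonal matrix `Γ_k`: `x_1, …, x_k` on the diagonal, `q_1, …, q_{k-1}` above it and
`-1` below it. -/
def giventalKim (k : ℕ) : Matrix (Fin k) (Fin k) Zqx := fun i j =>
  if i = j then xv i
  else if (j : ℕ) = i + 1 then qv i
  else if (i : ℕ) = j + 1 then -1
  else 0

/-- The quantum elementary polynomial `E_p^k`: the coefficient of `λ^p` in `det (1 + λ Γ_k)`. -/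
def qElem (p k : ℕ) : Zqx :=
  (1 + (Polynomial.X : Polynomial Zqx) • (giventalKim k).map Polynomial.C).det.coeff p

/-- `F_p^k = ∑_{I ⊆ [k], |I| = p} ∏_{i ∈ I} (1 - x_i) ∏_{i ∈ I, i + 1 ∉ I} (1 - q_i)`. -/
def fPoly (p k : ℕ) : Zqx :=
  ∑ I ∈ (Finset.range k).powersetCard p,
    (∏ i ∈ I, (1 - xv i)) * ∏ i ∈ I with i + 1 ∉ I, (1 - qv i)

/-- `Ê_p^k = ∑_{i=0}^p (-1)^i binom(k-i, p-i) F_i^k`. -/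
def eHat (p k : ℕ) : Zqx :=
  ∑ i ∈ Finset.range (p + 1), (-1) ^ i * ((k - i).choose (p - i) : Zqx) * fPoly i k

/-! ### The module `L_n` and its basis of standard elementary monomials -/

/-- The exponents `(i_1, …, i_{n-1})` with `0 ≤ i_j ≤ n - j` (and no other variables). -/
def stairExps (n : ℕ) : Set (ℕ →₀ ℕ) := {a | ∀ j, a j ≤ n - 1 - j}

/-- The `R`-module spanned by the monomials `x_1^{i_1} ⋯ x_{n-1}^{i_{n-1}}`, `0 ≤ i_j ≤ n - j`.
It is `L_n` for `R = ℤ`, and `L_n^q = ℤ[q] ⊗ L_n` for `R = ℤ[q]`. -/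
def stairModule (R : Type*) [CommRing R] (n : ℕ) : Submodule R (MvPolynomial ℕ R) :=
  restrictSupport R (stairExps n)

/-- The index set of the standard elementary monomials: sequences `(p_0, p_1, …, p_{n-1})` with
`0 ≤ p_k ≤ k`. The entry `p_0` is always `0`. -/
abbrev StdIndex (n : ℕ) : Type := (k : Fin n) → Fin ((k : ℕ) + 1)

/-- The product `T_{p_1}^1 ⋯ T_{p_{n-1}}^{n-1}` for a family `T_p^k` with `T_0^0 = 1`. -/
def stdMonomial {A : Type*} [CommRing A] (T : ℕ → ℕ → A) (n : ℕ) (p : StdIndex n) : A :=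
  ∏ k : Fin n, T (p k) k

section Basis

variable {R : Type*} [CommRing R]

/-- Elementary symmetric polynomial in the variables indexed by `s`. -/
def elemOn (R : Type*) [CommRing R] (s : Finset ℕ) (p : ℕ) : MvPolynomial ℕ R :=
  (s.val.map (X : ℕ → MvPolynomial ℕ R)).esymm p

lemma elemOn_eq (s : Finset ℕ) (p : ℕ) :
    elemOn R s p = ∑ I ∈ s.powersetCard p, ∏ i ∈ I, X i := by
  simp [elemOn, Finset.esymm_map_val]

lemma elemOn_zero (s : Finset ℕ) : elemOn R s 0 = 1 := by simp [elemOn_eq]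

lemma elemOn_of_lt (s : Finset ℕ) (p : ℕ) (h : s.card < p) : elemOn R s p = 0 := by
  rw [elemOn_eq, Finset.powersetCard_eq_empty.2 h, Finset.sum_empty]

lemma elemOn_insert (s : Finset ℕ) (j : ℕ) (hj : j ∉ s) (p : ℕ) :
    elemOn R (insert j s) (p + 1) = elemOn R s (p + 1) + X j * elemOn R s p := by
  classical
  simp only [elemOn_eq]
  rw [Finset.powersetCard_succ_insert hj, Finset.sum_union, Finset.mul_sum]
  · congr 1
    rw [Finset.sum_image]
    · refine Finset.sum_congr rfl fun I hI => ?_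
      rw [Finset.prod_insert]
      exact fun h => hj ((Finset.mem_powersetCard.1 hI).1 h)
    · intro I hI J hJ h
      have h1 : j ∉ I := fun h => hj ((Finset.mem_powersetCard.1 hI).1 h)
      have h2 : j ∉ J := fun h => hj ((Finset.mem_powersetCard.1 hJ).1 h)
      rw [← Finset.erase_insert h1, ← Finset.erase_insert h2, h]
  · rw [Finset.disjoint_left]
    intro I hI hI'
    obtain ⟨J, -, rfl⟩ := Finset.mem_image.1 hI'
    exact hj ((Finset.mem_powersetCard.1 hI).1 (Finset.mem_insert_self _ _))

lemma exchange_step {A : Type*} [CommRing A] [Algebra R A] (M : Submodule R A) (u x : A)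
    (ε ε' : ℕ → A) (m : ℕ) (h0 : ε 0 = ε' 0) (hs : ∀ p, ε (p + 1) = ε' (p + 1) + x * ε' p)
    (hz : ∀ p, m ≤ p → ε' p = 0) (hM : ∀ b < m, ∀ p, u * x ^ b * ε p ∈ M) :
    ∀ b ≤ m, ∀ p, u * x ^ b * ε' p ∈ M := by
  have h1 : ∀ p b, b + p < m → u * x ^ b * ε' p ∈ M := by
    intro p
    induction p with
    | zero => intro b hb; rw [← h0]; exact hM b (by omega) 0
    | succ p ih =>
      intro b hb
      have := M.sub_mem (hM b (by omega) (p + 1)) (ih (b + 1) (by omega))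
      rw [hs] at this
      convert this using 1
      ring
  have h2 : ∀ b p, b ≤ m → m ≤ b + p → u * x ^ b * ε' p ∈ M := by
    intro b
    induction b with
    | zero => intro p _ hp; rw [hz p (by omega)]; simp
    | succ b ih =>
      intro p hb hp
      have := M.sub_mem (hM b (by omega) (p + 1)) (ih (p + 1) (by omega) (by omega))
      rw [hs] at this
      convert this using 1
      ring
  intro b hb p
  rcases lt_or_ge (b + p) m with h | h
  · exact h1 p b h
  · exact h2 b p hb h

lemma monomial_erase (a : ℕ →₀ ℕ) (j : ℕ) :
    (monomial a (1 : R)) = monomial (a.erase j) 1 * X j ^ a j := by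
  rw [X_pow_eq_monomial, monomial_mul, one_mul, Finsupp.erase_add_single]

lemma mem_of_exchange (n : ℕ) (M : Submodule R (MvPolynomial ℕ R))
    (hM : ∀ a ∈ stairExps n, ∀ p, monomial a 1 * elem R p n ∈ M) :
    ∀ j ≤ n, ∀ a : ℕ →₀ ℕ, (∀ i, a i ≤ if i < j then n - i else n - 1 - i) →
      ∀ p, monomial a 1 * elemOn R (Finset.Ico j n) p ∈ M := by
  intro j
  induction j with
  | zero =>
    intro _ a ha p
    have := hM a (fun i => by simpa using ha i) p
    simpa [elem, elemOn, ← Nat.Ico_zero_eq_range] using this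
  | succ j ih =>
    intro hj a ha p
    have hIco : Finset.Ico j n = insert j (Finset.Ico (j + 1) n) :=
      (Finset.insert_Ico_succ_left_eq_Ico (by omega)).symm
    rw [monomial_erase a j]
    refine exchange_step M (monomial (a.erase j) 1) (X j) (elemOn R (Finset.Ico j n))
      (elemOn R (Finset.Ico (j + 1) n)) (n - j) ?_ ?_ ?_ ?_ (a j) ?_ p
    · simp [elemOn_zero]
    · intro p
      rw [hIco, elemOn_insert _ _ (by simp)]
    · intro p hp
      exact elemOn_of_lt _ _ (by simp; omega)
    · intro b hb p
      rw [X_pow_eq_monomial, monomial_mul, one_mul]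
      refine ih (by omega) _ (fun i => ?_) p
      have := ha i
      rcases eq_or_ne i j with rfl | hij
      · simp; omega
      · simp only [Finsupp.add_apply, Finsupp.erase_ne hij, Finsupp.single_eq_of_ne hij]
        split_ifs at this ⊢ <;> omega
    · have := ha j
      simpa using this

lemma stdMonomial_elem_succ_mem (n : ℕ) (f : MvPolynomial ℕ R)
    (hf : f ∈ Submodule.span R (Set.range (stdMonomial (elem R) n))) (p : ℕ) :
    f * elem R p n ∈ Submodule.span R (Set.range (stdMonomial (elem R) (n + 1))) := by
  rcases lt_or_ge n p with hp | hp
  · have : elem R p n = 0 := elemOn_of_lt (Finset.range n) p (by simpa using hp)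
    rw [this, mul_zero]
    exact Submodule.zero_mem _
  · induction hf using Submodule.span_induction with
    | mem f hf =>
      obtain ⟨s, rfl⟩ := hf
      refine Submodule.subset_span ⟨Fin.snoc (α := fun k : Fin (n + 1) => Fin ((k : ℕ) + 1)) s
        ⟨p, by simpa using Nat.lt_succ_of_le hp⟩, ?_⟩
      simp [stdMonomial, Fin.prod_univ_castSucc]
    | zero => simp
    | add f g _ _ h1 h2 => rw [add_mul]; exact Submodule.add_mem _ h1 h2
    | smul c f _ h => rw [smul_mul_assoc]; exact Submodule.smul_mem _ _ h

lemma stairModule_le_span (n : ℕ) :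
    stairModule R n ≤ Submodule.span R (Set.range (stdMonomial (elem R) n)) := by
  induction n with
  | zero =>
    rw [stairModule, restrictSupport_eq_span, Submodule.span_le]
    rintro _ ⟨a, ha, rfl⟩
    have : a = 0 := by ext j; simpa using ha j
    subst this
    exact Submodule.subset_span ⟨fun k => k.elim0, by simp [stdMonomial]⟩
  | succ n ih =>
    rw [stairModule, restrictSupport_eq_span, Submodule.span_le]
    rintro _ ⟨a, ha, rfl⟩
    have := mem_of_exchange n (Submodule.span R (Set.range (stdMonomial (elem R) (n + 1))))
      (fun b hb p => stdMonomial_elem_succ_mem n _ (ih (by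
        rw [stairModule, restrictSupport_eq_span]
        exact Submodule.subset_span ⟨b, hb, rfl⟩)) p) n le_rfl a (fun i => by
          have := ha i
          split_ifs <;> omega) 0
    simpa [elemOn_zero] using this

lemma mem_stairModule_iff {n : ℕ} {f : MvPolynomial ℕ R} :
    f ∈ stairModule R n ↔ ∀ j, degreeOf j f ≤ n - 1 - j := by
  simp only [stairModule, mem_restrictSupport_iff, degreeOf_le_iff]
  exact ⟨fun h j a ha => h ha j, fun h a ha j => h j a ha⟩

lemma degreeOf_elem_le (p k j : ℕ) : degreeOf j (elem R p k) ≤ if j < k then 1 else 0 := by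
  classical
  rcases subsingleton_or_nontrivial R with hR | hR
  · rw [Subsingleton.elim (elem R p k) 0, degreeOf_zero]
    exact Nat.zero_le _
  change degreeOf j (elemOn R (Finset.range k) p) ≤ _
  rw [elemOn_eq]
  refine (degreeOf_sum_le _ _ _).trans (Finset.sup_le fun I hI => ?_)
  refine (degreeOf_prod_le _ _ _).trans ?_
  simp only [degreeOf_X]
  rw [Finset.sum_ite_eq]
  split_ifs with h1 h2 <;> try omega
  exact absurd (Finset.mem_range.1 ((Finset.mem_powersetCard.1 hI).1 h1)) h2

lemma stdMonomial_elem_mem (n : ℕ) (p : StdIndex n) :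
    stdMonomial (elem R) n p ∈ stairModule R n := by
  rw [mem_stairModule_iff]
  intro j
  refine (degreeOf_prod_le _ _ _).trans
    ((Finset.sum_le_sum fun k _ => degreeOf_elem_le _ _ _).trans ?_)
  rw [Fin.sum_univ_eq_sum_range (fun k => if j < k then 1 else 0) n, Finset.sum_ite,
    Finset.sum_const_zero, add_zero, Finset.sum_const, smul_eq_mul, mul_one]
  have : (Finset.range n).filter (fun k => j < k) = Finset.Ioo j n := by
    ext k; simp [and_comm]
  rw [this, Nat.card_Ioo]
  omega

/-- The staircase exponents are in bijection with the indices of standard elementary monomials. -/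
def stairEquiv (n : ℕ) : stairExps n ≃ StdIndex n where
  toFun a k := ⟨a.1 (n - 1 - k), by have := a.2 (n - 1 - k); omega⟩
  invFun p := ⟨Finsupp.onFinset (Finset.range n)
      (fun j => if h : j < n then (p ⟨n - 1 - j, by omega⟩ : ℕ) else 0)
      (fun j hj => by by_contra h; simp at h; simp [Nat.not_lt.2 h] at hj), fun j => by
        simp only [Finsupp.onFinset_apply]
        split_ifs
        · exact Nat.lt_succ_iff.1 (p ⟨n - 1 - j, by omega⟩).2
        · omega⟩
  left_inv a := by
    ext j
    simp only [Finsupp.onFinset_apply]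
    split_ifs with h
    · congr 1; omega
    · have := a.2 j; omega
  right_inv p := by
    funext k
    ext
    have hk := k.2
    have : n - 1 - (n - 1 - (k : ℕ)) = k := by omega
    simp only [Finsupp.onFinset_apply]
    rw [dif_pos (by omega)]
    congr!

/-- The standard elementary monomials as elements of the module `L_n`. -/
def stdElem (R : Type*) [CommRing R] (n : ℕ) (p : StdIndex n) : stairModule R n :=
  ⟨stdMonomial (elem R) n p, stdMonomial_elem_mem n p⟩

lemma span_stdElem (n : ℕ) : ⊤ ≤ Submodule.span R (Set.range (stdElem R n)) := by
  have h : (Submodule.span R (Set.range (stdElem R n))).map (stairModule R n).subtype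
      = Submodule.span R (Set.range (stdMonomial (elem R) n)) := by
    rw [Submodule.map_span, ← Set.range_comp]
    rfl
  rintro ⟨f, hf⟩ -
  have := stairModule_le_span n hf
  rw [← h] at this
  obtain ⟨g, hg, rfl⟩ := this
  exact hg

lemma linearIndependent_stdElem (n : ℕ) : LinearIndependent R (stdElem R n) := by
  let b : Module.Basis (StdIndex n) R (stairModule R n) :=
    (basisRestrictSupport R (stairExps n)).reindex (stairEquiv n)
  let φ : stairModule R n →ₗ[R] stairModule R n := b.constr R (stdElem R n)
  have hφ : ∀ p, φ (b p) = stdElem R n p := fun p => b.constr_basis R _ p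
  have hsurj : Function.Surjective φ := by
    rw [← LinearMap.range_eq_top, Module.Basis.constr_range]
    exact top_le_iff.1 (span_stdElem n)
  have : Module.Finite R (stairModule R n) := Module.Finite.of_basis b
  have hinj : Function.Injective φ := OrzechProperty.injective_of_surjective_endomorphism φ hsurj
  have := b.linearIndependent.map' φ (LinearMap.ker_eq_bot.2 hinj)
  rwa [show φ ∘ b = stdElem R n from funext hφ] at this

/-- The standard elementary monomials `e_{p_1}^1 ⋯ e_{p_{n-1}}^{n-1}`, `0 ≤ p_k ≤ k`, form a basis
of the module `L_n` over any coefficient ring. -/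
def stdBasis (R : Type*) [CommRing R] (n : ℕ) : Module.Basis (StdIndex n) R (stairModule R n) :=
  Module.Basis.mk (linearIndependent_stdElem n) (span_stdElem n)

end Basis

/-- The `ℤ[q]`-linear map `L_n^q → ℤ[q, x]` which maps `e_{p_1}^1 ⋯ e_{p_{n-1}}^{n-1}` to
`T_{p_1}^1 ⋯ T_{p_{n-1}}^{n-1}` for all `0 ≤ p_k ≤ k`. It is the quantization map of quantum
cohomology for `T = E`, and of quantum K-theory for `T = Ê`. -/
def quantization (T : ℕ → ℕ → Zqx) (n : ℕ) : stairModule Zq n →ₗ[Zq] Zqx :=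
  (stdBasis Zq n).constr Zq (stdMonomial T n)

/-! ### Schubert and Grothendieck polynomials -/

/-- The action on polynomials of the transposition of `x_{i+1}` and `x_{i+2}`. -/
def swapX (i : ℕ) : Zx →ₐ[ℤ] Zx := rename (Equiv.swap i (i + 1))

lemma sub_dvd_sub_swapX (i : ℕ) (f : Zx) : (X i - X (i + 1) : Zx) ∣ f - swapX i f := by
  induction f using MvPolynomial.induction_on with
  | C a => simp [swapX]
  | add f g hf hg =>
    rw [map_add, add_sub_add_comm]
    exact dvd_add hf hg
  | mul_X f j hf =>
    have hj : (X i - X (i + 1) : Zx) ∣ X j - swapX i (X j) := by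
      rw [swapX, rename_X, Equiv.swap_apply_def]
      split_ifs with h1 h2
      · rw [h1]
      · rw [h2, ← neg_sub, neg_dvd.symm, neg_neg]
      · simp
    rw [map_mul, show f * X j - swapX i f * swapX i (X j)
      = (f - swapX i f) * X j + swapX i f * (X j - swapX i (X j)) by ring]
    exact dvd_add (hf.mul_right _) (hj.mul_left _)

/-- The divided difference operator `∂ = (1 - s) / (x_{i+1} - x_{i+2})`, where `s` transposes
`x_{i+1}` and `x_{i+2}`: the quotient, which exists by `sub_dvd_sub_swapX`. -/
def divDiff (i : ℕ) (f : Zx) : Zx := (sub_dvd_sub_swapX i f).choose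

lemma divDiff_spec (i : ℕ) (f : Zx) : (X i - X (i + 1)) * divDiff i f = f - swapX i f :=
  (sub_dvd_sub_swapX i f).choose_spec.symm

/-- The isobaric divided difference operator `π = 1 + (1 - x_{i+1}) ∂`. -/
def isoDivDiff (i : ℕ) (f : Zx) : Zx := f + (1 - X i) * divDiff i f

/-- `w` has an ascent at the (zero-based) position `i`, i.e. `w(i) < w(i+1)`. -/
def IsAscent {n : ℕ} (w : Equiv.Perm (Fin n)) (i : ℕ) : Prop :=
  ∃ h : i + 1 < n, w ⟨i, by omega⟩ < w ⟨i + 1, h⟩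

/-- `w s`, where `s` is the transposition of the (zero-based) adjacent positions `i`, `i + 1`. -/
def mulAdj {n : ℕ} (w : Equiv.Perm (Fin n)) (i : ℕ) (h : i + 1 < n) : Equiv.Perm (Fin n) :=
  w * Equiv.swap ⟨i, by omega⟩ ⟨i + 1, h⟩

lemma mulAdj_measure {n : ℕ} (w : Equiv.Perm (Fin n)) (i : ℕ) (h : i + 1 < n)
    (hw : w ⟨i, by omega⟩ < w ⟨i + 1, h⟩) :
    ∑ j : Fin n, (j : ℕ) * (mulAdj w i h j : ℕ) < ∑ j : Fin n, (j : ℕ) * (w j : ℕ) := by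
  set a : Fin n := ⟨i, by omega⟩ with ha
  set b : Fin n := ⟨i + 1, h⟩ with hb
  have hab : a ≠ b := by simp [ha, hb]
  have hba : b ∈ Finset.univ.erase a := by simp [hab.symm]
  rw [← Finset.add_sum_erase _ _ (Finset.mem_univ a), ← Finset.add_sum_erase _ _ hba,
    ← Finset.add_sum_erase _ (fun j : Fin n => (j : ℕ) * (w j : ℕ)) (Finset.mem_univ a),
    ← Finset.add_sum_erase _ (fun j : Fin n => (j : ℕ) * (w j : ℕ)) hba]
  have h1 : mulAdj w i h a = w b := by simp [mulAdj, ha, hb]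
  have h2 : mulAdj w i h b = w a := by simp [mulAdj, ha, hb]
  have h3 : ∑ j ∈ (Finset.univ.erase a).erase b, (j : ℕ) * (mulAdj w i h j : ℕ)
      = ∑ j ∈ (Finset.univ.erase a).erase b, (j : ℕ) * (w j : ℕ) := by
    refine Finset.sum_congr rfl fun j hj => ?_
    simp only [Finset.mem_erase, Finset.mem_univ, and_true] at hj
    have : mulAdj w i h j = w j := by
      simp only [mulAdj, Equiv.Perm.mul_apply]
      rw [Equiv.swap_apply_of_ne_of_ne hj.2 hj.1]
    rw [this]
  rw [h1, h2, h3]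
  have hlt : (w a : ℕ) < w b := hw
  have e1 : (a : ℕ) = i := rfl
  have e2 : (b : ℕ) = i + 1 := rfl
  rw [e1, e2]
  nlinarith

open Classical in
/-- For operators `D_1, …, D_{n-1}` on `ℤ[x]`, the polynomial `D_{i_1} ⋯ D_{i_l} (x^δ)`, where
`x^δ = x_1^{n-1} x_2^{n-2} ⋯ x_{n-1}` and `s_{i_1} ⋯ s_{i_l}` is a reduced word of `w⁻¹ w_0`, with
`w_0` the longest element of `S_n`. The reduced word used here is the one obtained by
repeatedly multiplying `w` on the right by the transposition at its first ascent, until `w_0`, the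
permutation without ascents, is reached. (For divided difference operators, and for
isobaric ones, the result does not depend on the reduced word, by the braid relations.) -/
def applyToTop (D : ℕ → Zx → Zx) {n : ℕ} (w : Equiv.Perm (Fin n)) : Zx :=
  if h : ∃ i, IsAscent w i then
    D (Nat.find h) (applyToTop D (mulAdj w (Nat.find h) (Nat.find_spec h).1))
  else ∏ j ∈ Finset.range n, X j ^ (n - 1 - j)
termination_by ∑ j : Fin n, (j : ℕ) * (w j : ℕ)
decreasing_by exact mulAdj_measure w _ _ (Nat.find_spec h).2

/-- The Schubert polynomial of `w ∈ S_n`. -/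
def schubert {n : ℕ} (w : Equiv.Perm (Fin n)) : Zx := applyToTop divDiff w

/-- The Grothendieck polynomial of `w ∈ S_n`. -/
def grothendieck {n : ℕ} (w : Equiv.Perm (Fin n)) : Zx := applyToTop isoDivDiff w

/-! ### Schubert and Grothendieck polynomials lie in `L_n` -/

lemma degreeOf_swapX (i j : ℕ) (f : Zx) :
    degreeOf j (swapX i f) = degreeOf (Equiv.swap i (i + 1) j) f := by
  have := degreeOf_rename_of_injective (p := f) (Equiv.swap i (i + 1)).injective
    (Equiv.swap i (i + 1) j)
  rwa [Equiv.swap_apply_self] at this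

lemma degreeOf_X_sub_X (i j : ℕ) :
    degreeOf j (X i - X (i + 1) : Zx) = if j = i ∨ j = i + 1 then 1 else 0 := by
  classical
  have key : ∀ a b : ℕ, a ≠ b → degreeOf a (X b : Zx) = 0 := fun a b h => degreeOf_X_of_ne h
  split_ifs with h
  · rcases h with rfl | rfl
    · rw [sub_eq_add_neg, degreeOf_add_eq_of_degreeOf_lt, degreeOf_X_self]
      rw [degreeOf_neg, key _ _ (by omega), degreeOf_X_self]
      exact one_pos
    · rw [← degreeOf_neg, neg_sub, sub_eq_add_neg, degreeOf_add_eq_of_degreeOf_lt, degreeOf_X_self]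
      rw [degreeOf_neg, key _ _ (by omega), degreeOf_X_self]
      exact one_pos
  · have := degreeOf_sub_le j (X i : Zx) (X (i + 1))
    rw [key j i (by omega), key j (i + 1) (by omega)] at this
    simpa using this

lemma degreeOf_divDiff_le (n i : ℕ) (f : Zx) (hf : f ∈ stairModule ℤ n) (j : ℕ) :
    degreeOf j (divDiff i f) ≤ if j = i then n - 1 - j - 1 else n - 1 - j := by
  rw [mem_stairModule_iff] at hf
  by_cases h0 : divDiff i f = 0
  · rw [h0]; simp
  have hne : (X i - X (i + 1) : Zx) ≠ 0 := by
    rw [sub_ne_zero]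
    intro h
    have := X_injective h
    omega
  have hmul := degreeOf_mul_eq (n := j) hne h0
  rw [divDiff_spec, degreeOf_X_sub_X] at hmul
  have hle := degreeOf_sub_le j f (swapX i f)
  rw [degreeOf_swapX] at hle
  have h1 := hf j
  have h2 := hf (Equiv.swap i (i + 1) j)
  rcases eq_or_ne j i with rfl | hji
  · rw [Equiv.swap_apply_left] at h2 hle
    simp at hmul ⊢
    omega
  · rcases eq_or_ne j (i + 1) with rfl | hji'
    · rw [Equiv.swap_apply_right] at h2 hle
      simp at hmul ⊢
      omega
    · rw [Equiv.swap_apply_of_ne_of_ne hji hji'] at h2 hle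
      simp [hji, hji'] at hmul ⊢
      omega

lemma divDiff_mem (n i : ℕ) (f : Zx) (hf : f ∈ stairModule ℤ n) :
    divDiff i f ∈ stairModule ℤ n := by
  rw [mem_stairModule_iff]
  intro j
  have := degreeOf_divDiff_le n i f hf j
  split_ifs at this <;> omega

lemma isoDivDiff_mem (n i : ℕ) (hi : i + 1 < n) (f : Zx) (hf : f ∈ stairModule ℤ n) :
    isoDivDiff i f ∈ stairModule ℤ n := by
  classical
  refine Submodule.add_mem _ hf ?_
  rw [mem_stairModule_iff]
  intro j
  have h1 := degreeOf_divDiff_le n i f hf j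
  have h2 := degreeOf_mul_le j (1 - X i : Zx) (divDiff i f)
  have h3 := degreeOf_sub_le j (1 : Zx) (X i)
  rw [degreeOf_one, degreeOf_X] at h3
  split_ifs at h1 h3 <;> omega

lemma applyToTop_mem (D : ℕ → Zx → Zx) (n : ℕ)
    (hD : ∀ i, i + 1 < n → ∀ f ∈ stairModule ℤ n, D i f ∈ stairModule ℤ n)
    (w : Equiv.Perm (Fin n)) : applyToTop D w ∈ stairModule ℤ n := by
  classical
  induction w using applyToTop.induct with
  | case1 w h ih =>
    rw [applyToTop, dif_pos h]
    exact hD _ (Nat.find_spec h).1 _ ih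
  | case2 w h =>
    rw [applyToTop, dif_neg h, mem_stairModule_iff]
    intro j
    refine (degreeOf_prod_le _ _ _).trans ?_
    have : ∀ i ∈ Finset.range n, degreeOf j (X i ^ (n - 1 - i) : Zx)
        ≤ if j = i then n - 1 - j else 0 := by
      intro i _
      refine (degreeOf_pow_le _ _ _).trans ?_
      rw [degreeOf_X]
      split_ifs with h <;> simp [h]
    refine (Finset.sum_le_sum this).trans ?_
    rw [Finset.sum_ite_eq]
    split_ifs <;> omega

lemma schubert_mem {n : ℕ} (w : Equiv.Perm (Fin n)) : schubert w ∈ stairModule ℤ n :=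
  applyToTop_mem _ n (fun i _ => divDiff_mem n i) w

lemma grothendieck_mem {n : ℕ} (w : Equiv.Perm (Fin n)) : grothendieck w ∈ stairModule ℤ n :=
  applyToTop_mem _ n (fun i hi => isoDivDiff_mem n i hi) w

lemma inclX_mem {n : ℕ} {f : Zx} (hf : f ∈ stairModule ℤ n) : inclX f ∈ stairModule Zq n := by
  rw [stairModule, mem_restrictSupport_iff] at hf ⊢
  exact (Finset.coe_subset.2 (support_map_subset _ _)).trans hf

/-! ### Quantum Schubert and quantum Grothendieck polynomials -/

/-- The quantum Schubert polynomial of `w ∈ S_n`. -/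
def qSchubert {n : ℕ} (w : Equiv.Perm (Fin n)) : Zqx :=
  quantization qElem n ⟨inclX (schubert w), inclX_mem (schubert_mem w)⟩

/-- The quantum Grothendieck polynomial of `w ∈ S_n`. -/
def qGrothendieck {n : ℕ} (w : Equiv.Perm (Fin n)) : Zqx :=
  quantization eHat n ⟨inclX (grothendieck w), inclX_mem (grothendieck_mem w)⟩

end

end QGroth

open MvPolynomial

namespace QGroth

noncomputable section

/-! Substituting `x ↦ T x`, `q ↦ T² q` turns homogeneous components into coefficients of `T`, so
statements about lowest components become expansions modulo powers of `T` (`LeadsWith`) that are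
stable under sums and products.

For part (1), let H_k, O_k and D_k be `hatGen k`, `openHatGen k` and `qGen k`, with zero-based
variables. Splitting subsets according to their largest possible element gives a coupled recursion
for H and O, which rearranges to H_{k+2} = H_{k+1} + λ² q_k (1 - x_k) O_k + λ (x_{k+1} + q_{k+1} -
x_{k+1} q_{k+1}) O_{k+1}. When λ has degree -1, the terms of degree zero reproduce the three-term
recursion of the tridiagonal determinant D_k, and the others have positive degree; this is
`hatGen_leadsWith`. At q = 0 the recursions for H, O and D all collapse to multiplication by 1 + λ
x_k.

For part (2), standard elementary monomials are homogeneous and linearly independent, so the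
coefficients of a polynomial on those of degree d depend only on its component of degree d
(`stdCoeff_eq_zero`). Both quantizations keep these integer coefficients (`quantization_inclX`). The
Schubert polynomial lives only in degree ℓ(w), and the Grothendieck polynomial agrees with it in all
degrees up to ℓ(w); with part (1) for each factor, `qGrothendieck_leadsWith` follows. The
specialization at q = 0 undoes quantization.

A lowest component must also be nonzero. By specialization, this reduces to the nonvanishing of
ordinary elementary and Schubert polynomials. For the latter, the same divided differences are
applied to an inhomogeneous deformation of the staircase monomial, whose values at permutations are
controlled (`Localizes`); `schubert_ne_zero` compares the top degrees. -/

/-! ### The grading as a scaling homomorphism, and leading terms -/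

/-- The homomorphism `x_i ↦ T x_i`, `q_i ↦ T² q_i`. -/
def scaleHom : Zqx →+* Polynomial Zqx :=
  ((aeval fun v : ℕ ⊕ ℕ => Polynomial.C (sumAlgEquiv ℤ ℕ ℕ (X v)) *
      (Polynomial.X : Polynomial Zqx) ^ (Sum.elim (fun _ => 1) (fun _ => 2) v : ℕ) :
    MvPolynomial (ℕ ⊕ ℕ) ℤ →ₐ[ℤ] Polynomial Zqx) : _ →+* _).comp
    ((sumAlgEquiv ℤ ℕ ℕ).symm : Zqx →+* MvPolynomial (ℕ ⊕ ℕ) ℤ)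

lemma scaleHom_xv (j : ℕ) : scaleHom (xv j) = Polynomial.C (xv j) * Polynomial.X := by
  simp [scaleHom, xv]

lemma scaleHom_qv (j : ℕ) : scaleHom (qv j) = Polynomial.C (qv j) * Polynomial.X ^ 2 := by
  simp [scaleHom, qv]

/-- Both sides are additive, and a monomial of weight e is scaled by exactly `T ^ e`. -/
lemma homComponent_eq_coeff_scaleHom (d : ℕ) (f : Zqx) :
    homComponent d f = (scaleHom f).coeff d := by
  classical
  obtain ⟨g, rfl⟩ := (sumAlgEquiv ℤ ℕ ℕ).surjective f
  simp only [homComponent, scaleHom, RingHom.comp_apply, RingHom.coe_coe, AlgEquiv.symm_apply_apply]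
  induction g using MvPolynomial.induction_on' with
  | add f g hf hg => simp only [map_add, hf, hg, Polynomial.coeff_add]
  | monomial s c =>
    have h1 : aeval (fun v : ℕ ⊕ ℕ => Polynomial.C (sumAlgEquiv ℤ ℕ ℕ (X v)) *
        (Polynomial.X : Polynomial Zqx) ^ (Sum.elim (fun _ => 1) (fun _ => 2) v : ℕ))
        (monomial s c) = Polynomial.C (sumAlgEquiv ℤ ℕ ℕ (monomial s c)) *
          Polynomial.X ^ (Finsupp.weight (Sum.elim (fun _ => 1) (fun _ => 2) : ℕ ⊕ ℕ → ℕ) s) := by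
      rw [aeval_monomial, monomial_eq, map_mul, Finsupp.prod, Finsupp.prod, map_prod,
        Finsupp.weight_apply, Finsupp.sum, ← Finset.prod_pow_eq_pow_sum, map_mul, map_prod,
        mul_assoc, ← Finset.prod_mul_distrib]
      congr 1
      · simp
      · refine Finset.prod_congr rfl fun v _ => ?_
        rw [mul_pow, ← pow_mul, smul_eq_mul, mul_comm (s v), map_pow, map_pow]
    rw [h1, Polynomial.coeff_C_mul_X_pow]
    split_ifs with h
    · rw [weightedHomogeneousComponent_eq_self]
      exact isWeightedHomogeneous_monomial _ _ _ h.symm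
    · rw [(isWeightedHomogeneous_monomial _ s c rfl).weightedHomogeneousComponent_ne d h,
        map_zero]

/-- `f` vanishes in degrees less than `d`, and `g` is its component of degree `d`. -/
def LeadsWith (f g : Zqx) (d : ℕ) : Prop :=
  ∃ h, scaleHom f = Polynomial.X ^ d * Polynomial.C g + Polynomial.X ^ (d + 1) * h

namespace LeadsWith

variable {f f' g g' : Zqx} {d d' : ℕ}

lemma zero (d : ℕ) : LeadsWith 0 0 d := ⟨0, by simp⟩

lemma xv (j : ℕ) : LeadsWith (xv j) (xv j) 1 := ⟨0, by rw [scaleHom_xv]; ring⟩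

lemma qv (j : ℕ) : LeadsWith (qv j) (qv j) 2 := ⟨0, by rw [scaleHom_qv]; ring⟩

lemma intCast (c : ℤ) : LeadsWith c c 0 := ⟨0, by simp⟩

lemma one : LeadsWith 1 1 0 := by simpa using intCast 1

lemma add (h : LeadsWith f g d) (h' : LeadsWith f' g' d) : LeadsWith (f + f') (g + g') d := by
  obtain ⟨u, hu⟩ := h
  obtain ⟨v, hv⟩ := h'
  exact ⟨u + v, by rw [map_add, hu, hv, map_add]; ring⟩

lemma neg (h : LeadsWith f g d) : LeadsWith (-f) (-g) d := by
  obtain ⟨u, hu⟩ := h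
  exact ⟨-u, by rw [map_neg, hu, map_neg]; ring⟩

lemma sub (h : LeadsWith f g d) (h' : LeadsWith f' g' d) : LeadsWith (f - f') (g - g') d := by
  simpa [sub_eq_add_neg] using h.add h'.neg

lemma mul (h : LeadsWith f g d) (h' : LeadsWith f' g' d') :
    LeadsWith (f * f') (g * g') (d + d') := by
  obtain ⟨u, hu⟩ := h
  obtain ⟨v, hv⟩ := h'
  exact ⟨Polynomial.C g * v + u * Polynomial.C g' + Polynomial.X * u * v, by
    rw [map_mul, hu, hv, map_mul]; ring⟩

/-- A zero leading term is allowed: this is how terms of too high a degree are discarded in the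
comparisons below. -/
lemma of_lt (h : LeadsWith f g d) (hd : d' < d) : LeadsWith f 0 d' := by
  obtain ⟨u, hu⟩ := h
  obtain ⟨e, rfl⟩ := Nat.exists_eq_add_of_lt hd
  exact ⟨Polynomial.X ^ e * (Polynomial.C g + Polynomial.X * u), by rw [hu, map_zero]; ring⟩

lemma sum {ι : Type*} (s : Finset ι) (F G : ι → Zqx) (h : ∀ i ∈ s, LeadsWith (F i) (G i) d) :
    LeadsWith (∑ i ∈ s, F i) (∑ i ∈ s, G i) d := by
  classical
  induction s using Finset.induction_on with
  | empty => exact zero d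
  | insert a s ha ih =>
    rw [Finset.sum_insert ha, Finset.sum_insert ha]
    exact (h a (by simp)).add (ih fun i hi => h i (by simp [hi]))

lemma prod {ι : Type*} (s : Finset ι) (F G : ι → Zqx) (D : ι → ℕ)
    (h : ∀ i ∈ s, LeadsWith (F i) (G i) (D i)) :
    LeadsWith (∏ i ∈ s, F i) (∏ i ∈ s, G i) (∑ i ∈ s, D i) := by
  classical
  induction s using Finset.induction_on with
  | empty => simpa using one
  | insert a s ha ih =>
    rw [Finset.prod_insert ha, Finset.prod_insert ha, Finset.sum_insert ha]
    exact (h a (by simp)).mul (ih fun i hi => h i (by simp [hi]))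

lemma isLowestComponent (h : LeadsWith f g d) (hg : g ≠ 0) : IsLowestComponent f g := by
  obtain ⟨u, hu⟩ := h
  refine ⟨hg, d, ?_, fun m hm => ?_⟩
  · rw [homComponent_eq_coeff_scaleHom, hu, Polynomial.coeff_add, Polynomial.coeff_X_pow_mul',
      Polynomial.coeff_X_pow_mul']
    simp
  · rw [homComponent_eq_coeff_scaleHom, hu, Polynomial.coeff_add, Polynomial.coeff_X_pow_mul',
      Polynomial.coeff_X_pow_mul', if_neg (by omega), if_neg (by omega), add_zero]

end LeadsWith

/-- Coefficientwise version of `LeadsWith`, with `λ` in degree `-1`. -/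
def PolyLeadsWith (A B : Polynomial Zqx) : Prop := ∀ p, LeadsWith (A.coeff p) (B.coeff p) p

namespace PolyLeadsWith

variable {A A' B B' : Polynomial Zqx}

lemma add (h : PolyLeadsWith A B) (h' : PolyLeadsWith A' B') :
    PolyLeadsWith (A + A') (B + B') := fun p => by
  simpa using (h p).add (h' p)

lemma sub (h : PolyLeadsWith A B) (h' : PolyLeadsWith A' B') :
    PolyLeadsWith (A - A') (B - B') := fun p => by
  simpa using (h p).sub (h' p)

lemma mul (h : PolyLeadsWith A B) (h' : PolyLeadsWith A' B') :
    PolyLeadsWith (A * A') (B * B') := fun p => by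
  rw [Polynomial.coeff_mul, Polynomial.coeff_mul]
  refine LeadsWith.sum _ _ _ fun i hi => ?_
  obtain rfl := Finset.HasAntidiagonal.mem_antidiagonal.1 hi
  exact (h i.1).mul (h' i.2)

lemma C_mul_X_pow {f g : Zqx} {d : ℕ} (h : LeadsWith f g d) :
    PolyLeadsWith (Polynomial.C f * Polynomial.X ^ d) (Polynomial.C g * Polynomial.X ^ d) :=
  fun p => by
    rw [Polynomial.coeff_C_mul_X_pow, Polynomial.coeff_C_mul_X_pow]
    split_ifs with hp
    · rwa [hp]
    · exact LeadsWith.zero p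

lemma C_mul_X_pow_zero {f g : Zqx} {d d' : ℕ} (h : LeadsWith f g d) (hd : d' < d) :
    PolyLeadsWith (Polynomial.C f * Polynomial.X ^ d') 0 := by
  simpa using C_mul_X_pow (h.of_lt hd)

lemma one : PolyLeadsWith 1 1 := by simpa using C_mul_X_pow LeadsWith.one

end PolyLeadsWith

/-! ### Generating polynomials of the Ê and their recursions -/

/-- The generating polynomial `∑_p Ê_p^k λ^p`. -/
def hatGen (k : ℕ) : Polynomial Zqx :=
  ∑ I ∈ (Finset.range k).powerset, (1 + Polynomial.X) ^ (k - I.card) * Polynomial.X ^ I.card *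
    Polynomial.C ((-1) ^ I.card * ((∏ i ∈ I, (1 - xv i)) * ∏ i ∈ I with i + 1 ∉ I, (1 - qv i)))

/-- The variant of `hatGen` in which the factor `1 - q_k` is left out. -/
def openHatGen (k : ℕ) : Polynomial Zqx :=
  ∑ I ∈ (Finset.range k).powerset, (1 + Polynomial.X) ^ (k - I.card) * Polynomial.X ^ I.card *
    Polynomial.C ((-1) ^ I.card * ((∏ i ∈ I, (1 - xv i)) *
      ∏ i ∈ I with i + 1 ∉ I ∧ i + 1 ≠ k, (1 - qv i)))

lemma coeff_hatGen {p k : ℕ} (h : p ≤ k) : (hatGen k).coeff p = eHat p k := by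
  rw [hatGen, Finset.sum_powerset, Finset.card_range, Polynomial.finsetSum_coeff, eHat]
  symm
  have hsub : Finset.range (p + 1) ⊆ Finset.range (k + 1) :=
    Finset.range_subset_range.2 (by omega)
  have key : ∀ i, (∑ I ∈ (Finset.range k).powersetCard i, (1 + Polynomial.X) ^ (k - I.card) *
      Polynomial.X ^ I.card * Polynomial.C ((-1) ^ I.card * ((∏ i ∈ I, (1 - xv i)) *
        ∏ i ∈ I with i + 1 ∉ I, (1 - qv i)))).coeff p =
      if i ≤ p then (-1) ^ i * ((k - i).choose (p - i) : Zqx) * fPoly i k else 0 := by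
    intro i
    rw [Polynomial.finsetSum_coeff, fPoly, ← ite_zero_mul, Finset.mul_sum]
    refine Finset.sum_congr rfl fun I hI => ?_
    rw [(Finset.mem_powersetCard.1 hI).2, Polynomial.coeff_mul_C, mul_comm _ (Polynomial.X ^ i),
      Polynomial.coeff_X_pow_mul', Polynomial.coeff_one_add_X_pow]
    split_ifs
    · ring
    · simp
  simp_rw [key]
  -- Subsets with more than `p` elements carry too high a power of λ to contribute.
  rw [← Finset.sum_subset hsub]
  · refine Finset.sum_congr rfl fun i hi => ?_
    rw [if_pos (by simpa [Nat.lt_succ_iff] using hi)]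
  · intro i _ hi
    rw [if_neg (by simpa [Nat.lt_succ_iff] using hi)]

lemma hatGen_zero : hatGen 0 = 1 := by simp [hatGen]

lemma openHatGen_zero : openHatGen 0 = 1 := by simp [openHatGen]

/-- Split the subsets by whether they contain `k`. Adjoining `k` contributes its own factor `1 -
q_k` and removes the factor of `k - 1` if that element is present, which is why `openHatGen` enters.
-/
lemma hatGen_succ (k : ℕ) : hatGen (k + 1) = (1 + Polynomial.X) * hatGen k -
    Polynomial.X * Polynomial.C ((1 - xv k) * (1 - qv k)) * openHatGen k := by
  classical
  rw [hatGen, Finset.range_add_one, Finset.sum_powerset_insert (by simp), sub_eq_add_neg]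
  congr 1
  · rw [hatGen, Finset.mul_sum]
    refine Finset.sum_congr rfl fun I hI => ?_
    have hc := Finset.card_le_card (Finset.mem_powerset.1 hI)
    rw [Finset.card_range] at hc
    rw [Nat.sub_add_comm hc, pow_succ]
    ring
  · rw [openHatGen, Finset.mul_sum, ← Finset.sum_neg_distrib]
    refine Finset.sum_congr rfl fun I hI => ?_
    have hk : k ∉ I := fun h => by simpa using Finset.mem_powerset.1 hI h
    have hk' : k + 1 ∉ I := fun h => by simpa using Finset.mem_powerset.1 hI h
    have hf : (insert k I).filter (fun i => i + 1 ∉ insert k I) =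
        insert k (I.filter fun i => i + 1 ∉ I ∧ i + 1 ≠ k) := by
      ext i
      simp only [Finset.mem_filter, Finset.mem_insert]
      constructor
      · tauto
      · rintro (rfl | h)
        · simp [hk']
        · tauto
    rw [hf, Finset.card_insert_of_notMem hk, Finset.prod_insert hk, Finset.prod_insert (by simp [hk]),
      Nat.add_sub_add_right]
    simp only [map_mul, map_pow, map_neg, map_one, pow_succ]
    ring_nf

lemma openHatGen_succ (k : ℕ) : openHatGen (k + 1) = (1 + Polynomial.X) * hatGen k -
    Polynomial.X * Polynomial.C (1 - xv k) * openHatGen k := by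
  classical
  rw [openHatGen, Finset.range_add_one, Finset.sum_powerset_insert (by simp), sub_eq_add_neg]
  congr 1
  · rw [hatGen, Finset.mul_sum]
    refine Finset.sum_congr rfl fun I hI => ?_
    have hc := Finset.card_le_card (Finset.mem_powerset.1 hI)
    have hk : k ∉ I := fun h => by simpa using Finset.mem_powerset.1 hI h
    have hf : I.filter (fun i => i + 1 ∉ I ∧ i + 1 ≠ k + 1) = I.filter fun i => i + 1 ∉ I := by
      refine Finset.filter_congr fun i hi => ?_
      have : i ≠ k := fun h => hk (h ▸ hi)
      simp [this]
    rw [Finset.card_range] at hc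
    rw [Nat.sub_add_comm hc, pow_succ, hf]
    ring
  · rw [openHatGen, Finset.mul_sum, ← Finset.sum_neg_distrib]
    refine Finset.sum_congr rfl fun I hI => ?_
    have hk : k ∉ I := fun h => by simpa using Finset.mem_powerset.1 hI h
    have hf : (insert k I).filter (fun i => i + 1 ∉ insert k I ∧ i + 1 ≠ k + 1) =
        I.filter fun i => i + 1 ∉ I ∧ i + 1 ≠ k := by
      ext i
      simp only [Finset.mem_filter, Finset.mem_insert]
      constructor
      · rintro ⟨rfl | h, h1, h2⟩
        · exact absurd rfl h2
        · tauto
      · rintro ⟨h, h1, h2⟩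
        refine ⟨Or.inr h, by tauto, fun h3 => hk ?_⟩
        rwa [← Nat.succ_injective h3]
    rw [hf, Finset.card_insert_of_notMem hk, Finset.prod_insert hk, Nat.add_sub_add_right]
    simp only [map_mul, map_pow, map_neg, map_one, pow_succ]
    ring_nf

/-! ### Tridiagonal determinants and the recursion for the E -/

/-- The tridiagonal matrix with entries `a` on, `b` above and `c` below the diagonal. -/
def tridiagonal {A : Type*} [CommRing A] (a b c : ℕ → A) (k : ℕ) : Matrix (Fin k) (Fin k) A :=
  fun i j => if (i : ℕ) = j then a i else if (j : ℕ) = i + 1 then b i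
    else if (i : ℕ) = j + 1 then c j else 0

/-- Expand along the last row, which has only two nonzero entries. -/
lemma det_tridiagonal_add_two {A : Type*} [CommRing A] (a b c : ℕ → A) (k : ℕ) :
    (tridiagonal a b c (k + 2)).det = a (k + 1) * (tridiagonal a b c (k + 1)).det -
      b k * c k * (tridiagonal a b c k).det := by
  set M := tridiagonal a b c with hM
  have hent : ∀ k (i j : Fin k), M k i j = if (i : ℕ) = j then a i else if (j : ℕ) = i + 1 then b i
    else if (i : ℕ) = j + 1 then c j else 0 := fun _ _ _ => rfl
  have hsub : ∀ k, (M (k + 1)).submatrix Fin.castSucc Fin.castSucc = M k := by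
    intro k
    ext i j : 2
    simp [hent]
  have e1 : (-1 : A) ^ (k + 1 + k) = -1 := Odd.neg_one_pow ⟨k, by ring⟩
  have e2 : (-1 : A) ^ (k + 1 + (k + 1)) = 1 := Even.neg_one_pow (Even.add_self (k + 1))
  have e3 : (-1 : A) ^ (k + k) = 1 := Even.neg_one_pow (Even.add_self k)
  have h1 : M (k + 2) (Fin.last _) (Fin.last _) = a (k + 1) := by simp [hent]
  have h2 : M (k + 2) (Fin.last _) (Fin.last k).castSucc = c k := by
    rw [hent, if_neg (by simp), if_neg (by simp; omega), if_pos (by simp)]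
    simp
  -- In the minor that omits the last row and the column `k`, the last column has `b k` as its only
  -- possibly nonzero entry, so expand along it.
  have h3 : ((M (k + 2)).submatrix (Fin.last (k + 1)).succAbove
      (Fin.last k).castSucc.succAbove).det = b k * (M k).det := by
    rw [Matrix.det_succ_column _ (Fin.last _), Fin.sum_univ_castSucc, Finset.sum_eq_zero]
    · have h4 : ((M (k + 2)).submatrix (Fin.last (k + 1)).succAbove
          (Fin.last k).castSucc.succAbove).submatrix (Fin.last k).succAbove
          (Fin.last k).succAbove = M k := by
        rw [← hsub k, ← hsub (k + 1), Matrix.submatrix_submatrix, Matrix.submatrix_submatrix]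
        congr 1
        · ext i; simp
        · ext i
          simp [Fin.succAbove, Fin.lt_def]
      rw [h4]
      simp [hent, e3]
    · intro i _
      have : M (k + 2) i.castSucc.castSucc (Fin.last _) = 0 := by
        have := i.2
        rw [hent]
        split_ifs <;> simp at * <;> omega
      simp [this]
  rw [Matrix.det_succ_row _ (Fin.last _), Fin.sum_univ_castSucc, Fin.sum_univ_castSucc,
    Finset.sum_eq_zero]
  · rw [h1, h2, h3]
    simp only [Fin.succAbove_last, hsub, Fin.val_last, Fin.val_castSucc, e1, e2]
    ring
  · intro i _
    have : M (k + 2) (Fin.last _) i.castSucc.castSucc = 0 := by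
      have := i.2
      rw [hent]
      split_ifs <;> simp at * <;> omega
    simp [this]

/-- The generating polynomial `det (1 + λ Γ_k) = ∑_p E_p^k λ^p`. -/
def qGen (k : ℕ) : Polynomial Zqx :=
  (1 + (Polynomial.X : Polynomial Zqx) • (giventalKim k).map Polynomial.C).det

lemma coeff_qGen (p k : ℕ) : (qGen k).coeff p = qElem p k := rfl

lemma qGen_zero : qGen 0 = 1 := by simp [qGen]

lemma qGen_one : qGen 1 = 1 + Polynomial.X * Polynomial.C (xv 0) := by
  simp [qGen, giventalKim]

lemma qGen_add_two (k : ℕ) : qGen (k + 2) =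
    (1 + Polynomial.X * Polynomial.C (xv (k + 1))) * qGen (k + 1) +
      Polynomial.X ^ 2 * Polynomial.C (qv k) * qGen k := by
  have key : ∀ k, qGen k = (tridiagonal (fun i => 1 + Polynomial.X * Polynomial.C (xv i))
      (fun i => Polynomial.X * Polynomial.C (qv i)) (fun _ => Polynomial.X * -1) k).det := by
    intro k
    rw [qGen]
    congr 1
    ext i j : 2
    simp only [tridiagonal, Matrix.add_apply, Matrix.smul_apply, Matrix.map_apply, giventalKim,
      Matrix.one_apply, Fin.ext_iff, smul_eq_mul]
    split_ifs <;> simp [-mul_neg]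
  rw [key, key, key, det_tridiagonal_add_two]
  ring

/-- The recursion for `qGen` has two steps, so consecutive values of `hatGen` are carried through
the induction together with `openHatGen`. -/
lemma hatGen_leadsWith (k : ℕ) :
    PolyLeadsWith (hatGen k) (qGen k) ∧ PolyLeadsWith (openHatGen k) (qGen k) ∧
    PolyLeadsWith (hatGen (k + 1)) (qGen (k + 1)) := by
  have hq0 : ∀ k, PolyLeadsWith (Polynomial.C (qv k) * Polynomial.X ^ 1) 0 := fun k =>
    PolyLeadsWith.C_mul_X_pow_zero (LeadsWith.qv k) (by omega)
  have hxq0 : ∀ k, PolyLeadsWith (Polynomial.C (xv k * qv k) * Polynomial.X ^ 1) 0 := fun k =>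
    PolyLeadsWith.C_mul_X_pow_zero ((LeadsWith.xv k).mul (LeadsWith.qv k)) (by omega)
  have hxq1 : ∀ k, PolyLeadsWith (Polynomial.C (xv k * qv k) * Polynomial.X ^ 2) 0 := fun k =>
    PolyLeadsWith.C_mul_X_pow_zero ((LeadsWith.xv k).mul (LeadsWith.qv k)) (by omega)
  have hx := fun k => PolyLeadsWith.C_mul_X_pow (LeadsWith.xv k)
  have hq := fun k => PolyLeadsWith.C_mul_X_pow (LeadsWith.qv k)
  induction k with
  | zero =>
    refine ⟨?_, ?_, ?_⟩
    · rw [hatGen_zero, qGen_zero]; exact PolyLeadsWith.one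
    · rw [openHatGen_zero, qGen_zero]; exact PolyLeadsWith.one
    · rw [qGen_one, hatGen_succ, hatGen_zero, openHatGen_zero]
      have := (PolyLeadsWith.one.add (hx 0)).add ((hq0 0).sub (hxq0 0))
      convert this using 1
      · simp only [map_mul, map_sub, map_one]; ring
      · ring
  | succ k ih =>
    obtain ⟨h1, h2, h3⟩ := ih
    have h4 : PolyLeadsWith (openHatGen (k + 1)) (qGen (k + 1)) := by
      -- Subtracting the two recursions gives O_{k+1} = H_{k+1} - λ q_k (1 - x_k) O_k, whose
      -- correction term has positive degree.
      have := h3.sub (((hq0 k).sub (hxq0 k)).mul h2)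
      convert this using 1
      · rw [openHatGen_succ, hatGen_succ]
        simp only [map_mul, map_sub, map_one]
        ring
      · ring
    refine ⟨h3, h4, ?_⟩
    -- In the formula for H_{k+2}, only `λ² q_k` and `λ x_{k+1}` have degree zero among the new
    -- coefficients.
    have := (h3.add (((hq k).sub (hxq1 k)).mul h2)).add
      (((hx (k + 1)).add ((hq0 (k + 1)).sub (hxq0 (k + 1)))).mul h4)
    convert this using 1
    · rw [hatGen_succ (k + 1), openHatGen_succ, hatGen_succ k]
      simp only [map_mul, map_sub, map_one]
      ring
    · rw [qGen_add_two]
      ring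

lemma eHat_leadsWith {p k : ℕ} (h : p ≤ k) : LeadsWith (eHat p k) (qElem p k) p := by
  rw [← coeff_hatGen h, ← coeff_qGen]
  exact (hatGen_leadsWith k).1 p

/-! ### Specialization at q = 0 and nonvanishing of the E -/

lemma specQ_xv (j : ℕ) : specQ (xv j) = X j := by simp [specQ, xv]

lemma specQ_qv (j : ℕ) : specQ (qv j) = 0 := by simp [specQ, qv]

/-- The generating polynomial `∏_{i ≤ k} (1 + λ x_i) = ∑_p e_p^k λ^p`. -/
def elemGen (k : ℕ) : Polynomial Zx :=
  ∏ i ∈ Finset.range k, (1 + Polynomial.X * Polynomial.C (X i))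

lemma coeff_elemGen (p k : ℕ) : (elemGen k).coeff p = elem ℤ p k := by
  change _ = elemOn ℤ (Finset.range k) p
  induction k generalizing p with
  | zero =>
    cases p with
    | zero => simp [elemGen, elemOn_zero]
    | succ p => rw [elemOn_of_lt _ _ (by simp)]; simp [elemGen, Polynomial.coeff_one]
  | succ k ih =>
    rw [elemGen, Finset.prod_range_succ, ← elemGen]
    cases p with
    | zero =>
      rw [elemOn_zero, Polynomial.mul_coeff_zero, ih, elemOn_zero]
      simp
    | succ p =>
      rw [Finset.range_add_one, elemOn_insert _ _ (by simp), ← ih, ← ih, mul_add, mul_one,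
        Polynomial.coeff_add, mul_left_comm, Polynomial.coeff_X_mul, Polynomial.coeff_mul_C,
        mul_comm]

lemma map_hatGen (k : ℕ) :
    (hatGen k).map specQ = elemGen k ∧ (openHatGen k).map specQ = elemGen k := by
  induction k with
  | zero => simp [hatGen_zero, openHatGen_zero, elemGen]
  | succ k ih =>
    rw [elemGen, Finset.prod_range_succ, ← elemGen]
    constructor
    · rw [hatGen_succ]
      simp only [Polynomial.map_sub, Polynomial.map_mul, Polynomial.map_add, Polynomial.map_one,
        Polynomial.map_X, Polynomial.map_C, map_mul, map_sub, map_one, specQ_xv, specQ_qv, ih.1,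
        ih.2, map_zero]
      ring
    · rw [openHatGen_succ]
      simp only [Polynomial.map_sub, Polynomial.map_mul, Polynomial.map_add, Polynomial.map_one,
        Polynomial.map_X, Polynomial.map_C, map_sub, map_one, specQ_xv, ih.1, ih.2]
      ring

lemma map_qGen (k : ℕ) :
    (qGen k).map specQ = elemGen k ∧ (qGen (k + 1)).map specQ = elemGen (k + 1) := by
  induction k with
  | zero => simp [qGen_zero, qGen_one, elemGen, specQ_xv]
  | succ k ih =>
    refine ⟨ih.2, ?_⟩
    rw [elemGen, Finset.prod_range_succ, ← elemGen, qGen_add_two]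
    simp only [Polynomial.map_mul, Polynomial.map_add, Polynomial.map_one, Polynomial.map_pow,
      Polynomial.map_X, Polynomial.map_C, specQ_xv, specQ_qv, ih.2, map_zero]
    ring

lemma specQ_eHat {p k : ℕ} (h : p ≤ k) : specQ (eHat p k) = elem ℤ p k := by
  rw [← coeff_hatGen h, ← Polynomial.coeff_map, (map_hatGen k).1, coeff_elemGen]

lemma specQ_qElem (p k : ℕ) : specQ (qElem p k) = elem ℤ p k := by
  rw [← coeff_qGen, ← Polynomial.coeff_map, (map_qGen k).1, coeff_elemGen]

lemma elem_ne_zero {p k : ℕ} (h : p ≤ k) : elem ℤ p k ≠ 0 := by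
  intro h0
  -- At the all-ones point the value is a binomial coefficient, positive since `p ≤ k`.
  have := congrArg (eval fun _ => (1 : ℤ)) h0
  change eval _ (elemOn ℤ (Finset.range k) p) = _ at this
  rw [elemOn_eq] at this
  simp at this
  exact absurd this (Nat.choose_pos h).ne'

lemma qElem_ne_zero {p k : ℕ} (h : p ≤ k) : qElem p k ≠ 0 := fun h0 =>
  elem_ne_zero h (by rw [← specQ_qElem, h0, map_zero])

/-! ### Divided differences and degrees -/

section HomogeneousMul

attribute [local instance] MvPolynomial.gradedAlgebra

lemma homogeneousComponent_add_mul {L : Zx} {m : ℕ} (hL : L.IsHomogeneous m) (n : ℕ) (f : Zx) :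
    homogeneousComponent (m + n) (L * f) = L * homogeneousComponent n f := by
  have := DirectSum.coe_decompose_mul_add_of_left_mem (homogeneousSubmodule ℕ ℤ) (j := n) (b := f)
    ((mem_homogeneousSubmodule m L).2 hL)
  erw [decomposition.decompose'_apply, decomposition.decompose'_apply] at this
  exact this

lemma homogeneousComponent_mul_of_lt {L : Zx} {m : ℕ} (hL : L.IsHomogeneous m) {n : ℕ}
    (hn : n < m) (f : Zx) : homogeneousComponent n (L * f) = 0 := by
  have := DirectSum.coe_decompose_mul_of_left_mem_of_not_le (homogeneousSubmodule ℕ ℤ) (b := f)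
    ((mem_homogeneousSubmodule m L).2 hL) (not_le.2 hn)
  erw [decomposition.decompose'_apply] at this
  exact this

end HomogeneousMul

lemma X_sub_X_ne_zero (i : ℕ) : (X i - X (i + 1) : Zx) ≠ 0 := by
  rw [sub_ne_zero]
  exact fun h => absurd (X_injective h) (by omega)

lemma divDiff_eq_of {i : ℕ} {f g : Zx} (h : (X i - X (i + 1)) * g = f - swapX i f) :
    divDiff i f = g :=
  mul_left_cancel₀ (X_sub_X_ne_zero i) ((divDiff_spec i f).trans h.symm)

lemma divDiff_zero (i : ℕ) : divDiff i 0 = 0 := divDiff_eq_of (by simp)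

lemma divDiff_sub (i : ℕ) (f g : Zx) : divDiff i (f - g) = divDiff i f - divDiff i g :=
  divDiff_eq_of (by rw [mul_sub, divDiff_spec, divDiff_spec, map_sub]; ring)

/-- Multiply by the linear form `X i - X (i + 1)`: it shifts degrees by one, and swapping variables
preserves degrees. -/
lemma homogeneousComponent_divDiff (i m : ℕ) (f : Zx) :
    homogeneousComponent m (divDiff i f) = divDiff i (homogeneousComponent (m + 1) f) := by
  refine (divDiff_eq_of ?_).symm
  rw [← homogeneousComponent_add_mul ((isHomogeneous_X ℤ i).sub (isHomogeneous_X ℤ (i + 1))),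
    divDiff_spec, map_sub, add_comm 1 m, swapX, rename_homogeneousComponent]

/-! ### Inversions -/

/-- The number of inversions of a permutation. -/
def inv {n : ℕ} (w : Equiv.Perm (Fin n)) : ℕ :=
  (Finset.univ.filter fun p : Fin n × Fin n => p.1 < p.2 ∧ w p.2 < w p.1).card

lemma mulAdj_left {n : ℕ} (w : Equiv.Perm (Fin n)) (i : ℕ) (h : i + 1 < n) :
    mulAdj w i h ⟨i, by omega⟩ = w ⟨i + 1, h⟩ := by simp [mulAdj]

lemma mulAdj_right {n : ℕ} (w : Equiv.Perm (Fin n)) (i : ℕ) (h : i + 1 < n) :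
    mulAdj w i h ⟨i + 1, h⟩ = w ⟨i, by omega⟩ := by simp [mulAdj]

lemma mulAdj_mulAdj {n : ℕ} (w : Equiv.Perm (Fin n)) (i : ℕ) (h : i + 1 < n) :
    mulAdj (mulAdj w i h) i h = w := by
  ext j
  simp [mulAdj]

lemma swap_lt_swap {n i : ℕ} (h : i + 1 < n) {x y : Fin n} (hxy : x < y)
    (hne : ¬(x = ⟨i, by omega⟩ ∧ y = ⟨i + 1, h⟩)) :
    Equiv.swap (⟨i, by omega⟩ : Fin n) ⟨i + 1, h⟩ x < Equiv.swap (⟨i, by omega⟩ : Fin n) ⟨i + 1, h⟩ y := by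
  simp only [Equiv.swap_apply_def, Fin.ext_iff, Fin.lt_def] at *
  split_ifs <;> simp <;> omega

/-- An adjacent transposition preserves the order of every pair of positions but `(i, i + 1)`. It
therefore carries the old inversions to new ones, and this pair is the only addition. -/
lemma inv_mulAdj {n : ℕ} (w : Equiv.Perm (Fin n)) (i : ℕ) (h : i + 1 < n)
    (hw : w ⟨i, by omega⟩ < w ⟨i + 1, h⟩) : inv (mulAdj w i h) = inv w + 1 := by
  set a : Fin n := ⟨i, by omega⟩ with ha
  set b : Fin n := ⟨i + 1, h⟩ with hb
  have hab : a < b := by simp [ha, hb, Fin.lt_def]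
  set s := Equiv.swap a b with hs
  have hmul : ∀ x, mulAdj w i h x = w (s x) := fun x => rfl
  have hsa : s a = b := Equiv.swap_apply_left a b
  have hsb : s b = a := Equiv.swap_apply_right a b
  have hss : ∀ x, s (s x) = x := fun x => Equiv.swap_apply_self a b x
  have hlt : ∀ x y, x < y → ¬(x = a ∧ y = b) → s x < s y := fun x y h1 h2 => swap_lt_swap h h1 h2
  have key : (Finset.univ.filter fun p : Fin n × Fin n => p.1 < p.2 ∧ mulAdj w i h p.2 < mulAdj w i h p.1)
      = insert (a, b) ((Finset.univ.filter fun p : Fin n × Fin n => p.1 < p.2 ∧ w p.2 < w p.1).map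
        (s.prodCongr s).toEmbedding) := by
    ext ⟨x, y⟩
    simp only [Finset.mem_filter, Finset.mem_univ, true_and, Finset.mem_insert, Finset.mem_map_equiv,
      hmul, Prod.mk.injEq, Equiv.prodCongr_symm, Equiv.prodCongr_apply, Prod.map_apply]
    rw [show s.symm = s from Equiv.symm_swap a b]
    constructor
    · rintro ⟨h1, h2⟩
      by_cases h3 : x = a ∧ y = b
      · exact Or.inl h3
      · exact Or.inr ⟨hlt x y h1 h3, h2⟩
    · rintro (⟨rfl, rfl⟩ | ⟨h1, h2⟩)
      · exact ⟨hab, by rwa [hsa, hsb]⟩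
      · refine ⟨?_, h2⟩
        have := hlt _ _ h1 (by
          rintro ⟨h3, h4⟩
          rw [h3, h4] at h2
          exact lt_asymm h2 hw)
        rwa [hss, hss] at this
  rw [inv, key, Finset.card_insert_of_notMem, Finset.card_map, inv]
  simp only [Finset.mem_map_equiv, Equiv.prodCongr_symm, Equiv.prodCongr_apply, Prod.map_apply,
    Finset.mem_filter, show s.symm = s from Equiv.symm_swap a b, hsa, hsb]
  exact fun h => lt_asymm hab h.2.1

lemma inv_of_descent {n : ℕ} (w : Equiv.Perm (Fin n)) (i : ℕ) (h : i + 1 < n)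
    (hw : w ⟨i + 1, h⟩ < w ⟨i, by omega⟩) : inv w = inv (mulAdj w i h) + 1 := by
  rw [← inv_mulAdj (mulAdj w i h) i h (by rwa [mulAdj_left, mulAdj_right]), mulAdj_mulAdj]

lemma inv_mulAdj_le {n : ℕ} (w : Equiv.Perm (Fin n)) (i : ℕ) (h : i + 1 < n) :
    inv (mulAdj w i h) ≤ inv w + 1 := by
  rcases lt_or_gt_of_ne (w.injective.ne (show (⟨i, by omega⟩ : Fin n) ≠ ⟨i + 1, h⟩ by simp)) with hw | hw
  · exact (inv_mulAdj w i h hw).le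
  · have := inv_of_descent w i h hw
    omega

lemma exists_descent {n : ℕ} (w : Equiv.Perm (Fin n)) (hw : inv w ≠ 0) :
    ∃ (i : ℕ) (h : i + 1 < n), w ⟨i + 1, h⟩ < w ⟨i, by omega⟩ := by
  by_contra! H
  apply hw
  have hmono : StrictMono w := by
    cases n with
    | zero => exact fun a => a.elim0
    | succ n =>
      refine Fin.strictMono_iff_lt_succ.2 fun i => ?_
      exact lt_of_le_of_ne (H i (by omega)) (w.injective.ne (by simp [Fin.ext_iff]))
  rw [inv, Finset.card_eq_zero, Finset.filter_eq_empty_iff]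
  exact fun p _ h => lt_asymm h.2 (hmono h.1)

lemma eq_rev_of_no_ascent {n : ℕ} (w : Equiv.Perm (Fin n)) (hw : ¬∃ i, IsAscent w i) :
    ∀ j, w j = j.rev := by
  have hanti : StrictAnti w := by
    cases n with
    | zero => exact fun a => a.elim0
    | succ n =>
      refine Fin.strictAnti_iff_succ_lt.2 fun i => ?_
      refine lt_of_le_of_ne (not_lt.1 fun h => hw ⟨i, by omega, h⟩)
        (w.injective.ne (by simp [Fin.ext_iff]))
  have h1 : StrictMono (w ∘ Fin.rev) := hanti.comp Fin.rev_strictAnti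
  -- Strictly monotone maps on `Fin n` with the same range coincide.
  have h2 : w ∘ Fin.rev = id := by
    refine (h1.range_inj strictMono_id).1 ?_
    rw [Set.range_id, (w.surjective.comp Fin.rev_surjective).range_eq]
  intro j
  simpa using congrFun h2 j.rev

lemma inv_of_no_ascent {n : ℕ} (w : Equiv.Perm (Fin n)) (hw : ¬∃ i, IsAscent w i) :
    inv w = ∑ j ∈ Finset.range n, (n - 1 - j) := by
  have h := eq_rev_of_no_ascent w hw
  rw [inv, ← Fin.sum_univ_eq_sum_range (fun j => n - 1 - j) n, Finset.card_filter,
    ← Finset.univ_product_univ, Finset.sum_product]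
  refine Finset.sum_congr rfl fun a _ => ?_
  simp only [h, Fin.rev_lt_rev, and_self]
  rw [← Finset.card_filter, Finset.filter_lt_eq_Ioi, Fin.card_Ioi]

/-! ### Schubert polynomials are homogeneous -/

lemma applyToTop_of_no_ascent (D : ℕ → Zx → Zx) {n : ℕ} (w : Equiv.Perm (Fin n))
    (hw : ¬∃ i, IsAscent w i) :
    applyToTop D w = ∏ j ∈ Finset.range n, X j ^ (n - 1 - j) := by
  rw [applyToTop, dif_neg hw]

/-- Induction along the reduced words used by `applyToTop`. -/
lemma applyToTop_induction (D E : ℕ → Zx → Zx) {n : ℕ}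
    (P : Equiv.Perm (Fin n) → Zx → Zx → Prop)
    (top : ∀ w : Equiv.Perm (Fin n), (¬∃ i, IsAscent w i) →
      P w (∏ j ∈ Finset.range n, X j ^ (n - 1 - j)) (∏ j ∈ Finset.range n, X j ^ (n - 1 - j)))
    (step : ∀ (w : Equiv.Perm (Fin n)) (i : ℕ) (h : i + 1 < n),
      w ⟨i, by omega⟩ < w ⟨i + 1, h⟩ → ∀ f g, P (mulAdj w i h) f g → P w (D i f) (E i g))
    (w : Equiv.Perm (Fin n)) : P w (applyToTop D w) (applyToTop E w) := by
  classical
  induction w using applyToTop.induct with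
  | case1 w h ih =>
    rw [applyToTop.eq_1 D w, dif_pos h, applyToTop.eq_1 E w, dif_pos h]
    exact step w _ (Nat.find_spec h).1 (Nat.find_spec h).2 _ _ ih
  | case2 w h =>
    rw [applyToTop_of_no_ascent D w h, applyToTop_of_no_ascent E w h]
    exact top w h

lemma isHomogeneous_top (n : ℕ) :
    (∏ j ∈ Finset.range n, X j ^ (n - 1 - j) : Zx).IsHomogeneous
      (∑ j ∈ Finset.range n, (n - 1 - j)) :=
  IsHomogeneous.prod _ _ _ fun j _ => isHomogeneous_X_pow j _

lemma homogeneousComponent_of_ne {f : Zx} {d m : ℕ} (hf : f.IsHomogeneous d) (hm : m ≠ d) :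
    homogeneousComponent m f = 0 := by
  rw [homogeneousComponent_of_mem hf, if_neg hm]

lemma homogeneousComponent_schubert {n : ℕ} (w : Equiv.Perm (Fin n)) {m : ℕ} (hm : m ≠ inv w) :
    homogeneousComponent m (schubert w) = 0 := by
  revert m
  refine applyToTop_induction divDiff divDiff
    (fun w f _ => ∀ {m : ℕ}, m ≠ inv w → homogeneousComponent m f = 0) ?_ ?_ w
  · intro w hw m hm
    rw [inv_of_no_ascent w hw] at hm
    exact homogeneousComponent_of_ne (isHomogeneous_top n) hm
  · intro w i h hw f _ ih m hm
    rw [homogeneousComponent_divDiff, ih, divDiff_zero]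
    rw [inv_mulAdj w i h hw]
    omega

/-- The induction must also carry the vanishing of the Grothendieck polynomial below degree ℓ(w),
which disposes of the terms of the isobaric operator other than ∂. -/
lemma homogeneousComponent_grothendieck_sub_schubert {n : ℕ} (w : Equiv.Perm (Fin n)) {m : ℕ}
    (hm : m ≤ inv w) : homogeneousComponent m (grothendieck w - schubert w) = 0 := by
  suffices H : (∀ {m : ℕ}, m < inv w → homogeneousComponent m (grothendieck w) = 0) ∧
      ∀ {m : ℕ}, m ≤ inv w → homogeneousComponent m (grothendieck w - schubert w) = 0 from H.2 hm
  refine applyToTop_induction isoDivDiff divDiff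
    (fun w f g => (∀ {m : ℕ}, m < inv w → homogeneousComponent m f = 0) ∧
      ∀ {m : ℕ}, m ≤ inv w → homogeneousComponent m (f - g) = 0) ?_ ?_ w
  · intro w hw
    refine ⟨fun hm => ?_, fun _ => by simp⟩
    rw [inv_of_no_ascent w hw] at hm
    exact homogeneousComponent_of_ne (isHomogeneous_top n) hm.ne
  · intro w i h hw f g ⟨ih1, ih2⟩
    rw [inv_mulAdj w i h hw] at ih1 ih2
    have hX : ∀ {m : ℕ}, m ≤ inv w → homogeneousComponent m (X i * divDiff i f) = 0 := by
      intro m hm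
      cases m with
      | zero => exact homogeneousComponent_mul_of_lt (isHomogeneous_X ℤ i) one_pos _
      | succ m =>
        rw [add_comm, homogeneousComponent_add_mul (isHomogeneous_X ℤ i),
          homogeneousComponent_divDiff, ih1 (by omega), divDiff_zero, mul_zero]
    constructor
    · intro m hm
      rw [isoDivDiff, sub_mul, one_mul, map_add, map_sub, ih1 (by omega), hX hm.le,
        homogeneousComponent_divDiff, ih1 (by omega), divDiff_zero]
      simp
    · intro m hm
      -- The terms `f` and `X i * divDiff i f` start in degree at least ℓ(w) + 1, so only the
      -- divided difference of `f - g` remains to be controlled.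
      rw [isoDivDiff, show f + (1 - X i) * divDiff i f - divDiff i g
        = f - X i * divDiff i f + divDiff i (f - g) by rw [divDiff_sub]; ring, map_add, map_sub,
        ih1 (by omega), hX hm, homogeneousComponent_divDiff, ih2 (by omega), divDiff_zero]
      simp

/-! ### Schubert polynomials are nonzero -/

/-- The point `(v(0), v(1), …)`. -/
def permPoint {n : ℕ} (v : Equiv.Perm (Fin n)) (j : ℕ) : ℤ := if h : j < n then (v ⟨j, h⟩ : ℕ) else 0

lemma eval_swapX {n : ℕ} (v : Equiv.Perm (Fin n)) (i : ℕ) (h : i + 1 < n) (f : Zx) :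
    eval (permPoint v) (swapX i f) = eval (permPoint (mulAdj v i h)) f := by
  rw [swapX, eval_rename]
  congr 2
  funext j
  simp only [Function.comp_apply, permPoint]
  rcases eq_or_ne j i with rfl | h1
  · rw [Equiv.swap_apply_left, dif_pos h, dif_pos (by omega), mulAdj_left]
  · rcases eq_or_ne j (i + 1) with rfl | h2
    · rw [Equiv.swap_apply_right, dif_pos h, dif_pos (by omega), mulAdj_right]
    · rw [Equiv.swap_apply_of_ne_of_ne h1 h2]
      split_ifs with h3
      · rw [mulAdj, Equiv.Perm.mul_apply, Equiv.swap_apply_of_ne_of_ne] <;> simpa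
      · rfl

/-- The coordinates of `permPoint v` at `i` and `i + 1` are distinct, so the denominator does not
vanish there. -/
lemma eval_divDiff {n : ℕ} (v : Equiv.Perm (Fin n)) (i : ℕ) (h : i + 1 < n) (f : Zx) :
    eval (permPoint v) (divDiff i f) = 0 ↔
      eval (permPoint v) f = eval (permPoint (mulAdj v i h)) f := by
  have h1 := congrArg (eval (permPoint v)) (divDiff_spec i f)
  rw [map_mul, map_sub, map_sub, eval_X, eval_X, eval_swapX v i h] at h1
  have h2 : permPoint v i - permPoint v (i + 1) ≠ 0 := by
    rw [permPoint, permPoint, dif_pos h, dif_pos (by omega), sub_ne_zero]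
    intro h3
    have := v.injective (Fin.ext (Nat.cast_injective h3))
    simp at this
  rw [← sub_eq_zero (a := eval _ f), ← h1]
  simp [h2]

/-- `f` does not vanish at `w`, but it vanishes at the other permutations of at most that
length. -/
def Localizes {n : ℕ} (w : Equiv.Perm (Fin n)) (f : Zx) : Prop :=
  eval (permPoint w) f ≠ 0 ∧ ∀ v, inv v ≤ inv w → v ≠ w → eval (permPoint v) f = 0

/-- If ℓ(v) ≤ ℓ(w), then `f` vanishes at v, so its divided difference is nonzero at v exactly when
`f` is nonzero at v s. As ℓ(v s) ≤ ℓ(w s), this forces v = w. -/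
lemma Localizes.divDiff {n : ℕ} {w : Equiv.Perm (Fin n)} {i : ℕ} (h : i + 1 < n)
    (hw : w ⟨i, by omega⟩ < w ⟨i + 1, h⟩) {f : Zx} (hf : Localizes (mulAdj w i h) f) :
    Localizes w (divDiff i f) := by
  obtain ⟨h1, h2⟩ := hf
  rw [inv_mulAdj w i h hw] at h2
  have hle : ∀ v : Equiv.Perm (Fin n), inv v ≤ inv w → eval (permPoint v) f = 0 := by
    refine fun v hv => h2 v (by omega) ?_
    rintro rfl
    rw [inv_mulAdj w i h hw] at hv
    omega
  constructor
  · rw [Ne, eval_divDiff w i h, hle w le_rfl]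
    exact h1.symm
  · intro v hv hvw
    rw [eval_divDiff v i h, hle v hv, h2]
    · exact (inv_mulAdj_le v i h).trans (by omega)
    · intro h3
      apply hvw
      rw [← mulAdj_mulAdj v i h, h3, mulAdj_mulAdj]

/-- Descend from `w` to length zero by ℓ(w) divided differences. The result is still nonzero at a
point, and each operator lowers degrees by one, so `f` has a component in degree at least ℓ(w). -/
lemma Localizes.exists_homogeneousComponent_ne_zero {n : ℕ} {w : Equiv.Perm (Fin n)} {f : Zx}
    (hf : Localizes w f) : ∃ m, inv w ≤ m ∧ homogeneousComponent m f ≠ 0 := by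
  induction hk : inv w generalizing w f with
  | zero =>
    by_contra! H
    apply hf.1
    rw [← sum_homogeneousComponent f, Finset.sum_eq_zero fun m _ => H m (Nat.zero_le m), map_zero]
  | succ k ih =>
    obtain ⟨i, h, hw⟩ := exists_descent w (by omega)
    have hinv := inv_of_descent w i h hw
    have hloc : Localizes (mulAdj w i h) (QGroth.divDiff i f) :=
      Localizes.divDiff h (by rwa [mulAdj_left, mulAdj_right]) (by rwa [mulAdj_mulAdj])
    obtain ⟨m, hm, hne⟩ := ih hloc (by omega)
    refine ⟨m + 1, by omega, fun h0 => hne ?_⟩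
    rw [homogeneousComponent_divDiff, h0, divDiff_zero]

lemma homogeneousComponent_prod_sub_prod {ι : Type*} (s : Finset ι) (a : ι → ℕ) (c : ι → ℤ)
    {m : ℕ} (hm : s.card ≤ m) :
    homogeneousComponent m (∏ i ∈ s, (X (a i) - C (c i)) - ∏ i ∈ s, X (a i) : Zx) = 0 := by
  classical
  induction s using Finset.induction_on generalizing m with
  | empty => simp
  | insert j s hj ih =>
    rw [Finset.card_insert_of_notMem hj] at hm
    obtain ⟨m, rfl⟩ : ∃ m', m = 1 + m' := ⟨m - 1, by omega⟩
    have h1 : homogeneousComponent (1 + m) (∏ i ∈ s, X (a i) : Zx) = 0 := by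
      refine homogeneousComponent_of_ne (d := ∑ i ∈ s, 1)
        (IsHomogeneous.prod _ _ _ fun i _ => isHomogeneous_X ℤ (a i)) ?_
      simp
      omega
    have h2 := ih (m := 1 + m) (by omega)
    rw [map_sub, h1, sub_zero] at h2
    -- With P' the shifted product over `s` and P the plain one, (X - c) P' - X P = X (P' - P) - c
    -- P', and P' has no component in degree `1 + m`.
    rw [Finset.prod_insert hj, Finset.prod_insert hj, sub_mul, sub_right_comm, ← mul_sub, map_sub,
      homogeneousComponent_add_mul (isHomogeneous_X ℤ _), ih (by omega),
      homogeneousComponent_C_mul, h2]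
    simp

/-- The polynomial `∏_{i + j ≤ n} (x_i - j)`, up to a shift of the indices. -/
def shiftedTop (n : ℕ) : Zx :=
  ∏ p ∈ (Finset.range n).sigma fun j => Finset.range (n - 1 - j), (X p.1 - C (p.2 : ℤ))

lemma localizes_shiftedTop {n : ℕ} (w : Equiv.Perm (Fin n)) (hw : ¬∃ i, IsAscent w i) :
    Localizes w (shiftedTop n) := by
  have hrev := eq_rev_of_no_ascent w hw
  have hval : ∀ j, (w j : ℕ) = n - 1 - j := fun j => by rw [hrev, Fin.val_rev]; omega
  constructor
  · simp only [shiftedTop, map_prod, map_sub, eval_X, eval_C]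
    refine Finset.prod_ne_zero_iff.2 fun ⟨j, c⟩ hp => ?_
    simp only [Finset.mem_sigma, Finset.mem_range] at hp
    rw [permPoint, dif_pos hp.1, hval]
    simp only
    omega
  · intro v _ hv
    by_contra H
    simp only [shiftedTop, map_prod, map_sub, eval_X, eval_C] at H
    rw [← ne_eq, Finset.prod_ne_zero_iff] at H
    have hge : ∀ j, (w j : ℕ) ≤ v j := by
      intro j
      by_contra! h
      rw [hval] at h
      -- If `v j < n - 1 - j`, then `X j - v j` is one of the factors, and it vanishes at v.
      refine H ⟨j, v j⟩ ?_ ?_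
      · simp [h]
      · simp [permPoint]
    -- Two permutations have equal sums of values, so the pointwise inequality is an equality.
    have hsum : ∑ j, (w j : ℕ) = ∑ j, (v j : ℕ) := by
      rw [Equiv.sum_comp w (fun j => (j : ℕ)), Equiv.sum_comp v (fun j => (j : ℕ))]
    rw [Finset.sum_eq_sum_iff_of_le fun j _ => hge j] at hsum
    exact hv (Equiv.ext fun j => Fin.ext (hsum j (Finset.mem_univ j)).symm)

/-- The deformation `g` differs from the Schubert polynomial only in degrees below ℓ(w), yet
localization at `w` gives it a nonzero component in degree at least ℓ(w). -/
lemma schubert_ne_zero {n : ℕ} (w : Equiv.Perm (Fin n)) : schubert w ≠ 0 := by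
  have H : ∃ g, Localizes w g ∧
      ∀ m, inv w ≤ m → homogeneousComponent m (g - schubert w) = 0 := by
    refine applyToTop_induction divDiff divDiff
      (fun w f _ => ∃ g, Localizes w g ∧
        ∀ m, inv w ≤ m → homogeneousComponent m (g - f) = 0) ?_ ?_ w
    · refine fun w hw => ⟨shiftedTop n, localizes_shiftedTop w hw, fun m hm => ?_⟩
      rw [inv_of_no_ascent w hw] at hm
      have := homogeneousComponent_prod_sub_prod (m := m)
        ((Finset.range n).sigma fun j => Finset.range (n - 1 - j)) (fun p => p.1)
        (fun p => (p.2 : ℤ)) (by simpa using hm)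
      rwa [Finset.prod_sigma (f := fun p => (X p.1 : Zx)),
        Finset.prod_congr rfl fun j _ => (Finset.prod_const (s := Finset.range (n - 1 - j))
          (X j : Zx)).trans (by rw [Finset.card_range])] at this
    · rintro w i h hw f _ ⟨g, hg, hd⟩
      refine ⟨divDiff i g, hg.divDiff h hw, fun m hm => ?_⟩
      rw [← divDiff_sub, homogeneousComponent_divDiff, hd, divDiff_zero]
      rw [inv_mulAdj w i h hw]
      omega
  obtain ⟨g, hg, hd⟩ := H
  obtain ⟨m, hm, hne⟩ := hg.exists_homogeneousComponent_ne_zero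
  intro h0
  apply hne
  have := hd m hm
  rwa [h0, sub_zero] at this

/-! ### Expansions in standard elementary monomials -/

lemma elem_isHomogeneous (p k : ℕ) : (elem ℤ p k).IsHomogeneous p := by
  change (elemOn ℤ (Finset.range k) p).IsHomogeneous p
  rw [elemOn_eq]
  refine IsHomogeneous.sum _ _ _ fun I hI => ?_
  have := IsHomogeneous.prod I (fun i => (X i : Zx)) (fun _ => 1) fun i _ => isHomogeneous_X ℤ i
  simpa [(Finset.mem_powersetCard.1 hI).2] using this

/-- The degree of a standard elementary monomial. -/
def stdDegree {n : ℕ} (p : StdIndex n) : ℕ := ∑ k, (p k : ℕ)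

lemma stdMonomial_elem_isHomogeneous {n : ℕ} (p : StdIndex n) :
    (stdMonomial (elem ℤ) n p).IsHomogeneous (stdDegree p) :=
  IsHomogeneous.prod _ _ _ fun k _ => elem_isHomogeneous (p k) k

lemma stdMonomial_leadsWith {n : ℕ} (p : StdIndex n) :
    LeadsWith (stdMonomial eHat n p) (stdMonomial qElem n p) (stdDegree p) :=
  LeadsWith.prod _ _ _ _ fun k _ => eHat_leadsWith (Nat.lt_succ_iff.1 (p k).2)

/-- The coefficient of a standard elementary monomial in `f ∈ L_n`. -/
def stdCoeff {n : ℕ} {f : Zx} (hf : f ∈ stairModule ℤ n) (p : StdIndex n) : ℤ :=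
  (stdBasis ℤ n).repr ⟨f, hf⟩ p

variable {n : ℕ} {f : Zx}

lemma sum_stdCoeff (hf : f ∈ stairModule ℤ n) :
    ∑ p, stdCoeff hf p • stdMonomial (elem ℤ) n p = f := by
  have := congrArg Subtype.val ((stdBasis ℤ n).sum_repr ⟨f, hf⟩)
  rw [Submodule.coe_sum] at this
  simpa [stdBasis, stdCoeff, stdElem] using this

lemma stdCoeff_sub {g : Zx} (hf : f ∈ stairModule ℤ n) (hg : g ∈ stairModule ℤ n)
    (p : StdIndex n) :
    stdCoeff (Submodule.sub_mem _ hf hg) p = stdCoeff hf p - stdCoeff hg p := by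
  rw [stdCoeff, stdCoeff, stdCoeff, ← Finsupp.sub_apply, ← map_sub]
  rfl

lemma stdCoeff_eq_zero (hf : f ∈ stairModule ℤ n) (p : StdIndex n)
    (h : homogeneousComponent (stdDegree p) f = 0) : stdCoeff hf p = 0 := by
  classical
  rw [← sum_stdCoeff hf, map_sum] at h
  have h1 : ∑ q ∈ Finset.univ.filter (fun q => stdDegree q = stdDegree p),
      stdCoeff hf q • stdElem ℤ n q = 0 := by
    apply Subtype.ext
    rw [Submodule.coe_sum, Submodule.coe_zero, ← h, Finset.sum_filter]
    refine Finset.sum_congr rfl fun q _ => ?_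
    rw [map_zsmul, homogeneousComponent_of_mem (stdMonomial_elem_isHomogeneous q)]
    by_cases hq : stdDegree q = stdDegree p
    · rw [if_pos hq, if_pos hq.symm]
      rfl
    · rw [if_neg hq, if_neg (Ne.symm hq), smul_zero]
  exact linearIndependent_iff'.1 (linearIndependent_stdElem (R := ℤ) n) _ _ h1 p (by simp)

lemma inclX_elem (p k : ℕ) : inclX (elem ℤ p k) = elem Zq p k := by
  change inclX (elemOn ℤ (Finset.range k) p) = elemOn Zq (Finset.range k) p
  simp [elemOn_eq, inclX]

/-- The inclusion into ℤ[q, x] sends the standard basis over ℤ to the one over ℤ[q], so the integer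
expansion persists. -/
lemma quantization_inclX (T : ℕ → ℕ → Zqx) (hf : f ∈ stairModule ℤ n) :
    quantization T n ⟨inclX f, inclX_mem hf⟩ = ∑ p, (stdCoeff hf p : Zqx) * stdMonomial T n p := by
  have h1 : (⟨inclX f, inclX_mem hf⟩ : stairModule Zq n) =
      ∑ p, stdCoeff hf p • stdBasis Zq n p := by
    apply Subtype.ext
    rw [Submodule.coe_sum]
    change inclX f = _
    conv_lhs => rw [← sum_stdCoeff hf]
    rw [map_sum]
    refine Finset.sum_congr rfl fun p _ => ?_
    rw [map_zsmul, stdMonomial, map_prod]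
    simp only [inclX_elem, stdBasis, Module.Basis.mk_apply]
    rfl
  rw [h1, map_sum]
  refine Finset.sum_congr rfl fun p _ => ?_
  rw [map_zsmul, quantization, Module.Basis.constr_basis, zsmul_eq_mul]

lemma specQ_quantization (T : ℕ → ℕ → Zqx) (hT : ∀ p k, p ≤ k → specQ (T p k) = elem ℤ p k)
    (hf : f ∈ stairModule ℤ n) : specQ (quantization T n ⟨inclX f, inclX_mem hf⟩) = f := by
  rw [quantization_inclX T hf, map_sum]
  conv_rhs => rw [← sum_stdCoeff hf]
  refine Finset.sum_congr rfl fun p _ => ?_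
  rw [map_mul, map_intCast, zsmul_eq_mul, stdMonomial, stdMonomial, map_prod]
  congr 1
  exact Finset.prod_congr rfl fun k _ => hT _ _ (Nat.lt_succ_iff.1 (p k).2)

/-! ### Comparison of quantum Grothendieck and quantum Schubert polynomials -/

lemma qSchubert_ne_zero (w : Equiv.Perm (Fin n)) : qSchubert w ≠ 0 := fun h => by
  apply schubert_ne_zero w
  rw [← specQ_quantization qElem (fun p k _ => specQ_qElem p k) (schubert_mem w), ← qSchubert, h,
    map_zero]

lemma qGrothendieck_leadsWith (w : Equiv.Perm (Fin n)) :
    LeadsWith (qGrothendieck w) (qSchubert w) (inv w) := by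
  rw [qGrothendieck, qSchubert, quantization_inclX _ (grothendieck_mem w),
    quantization_inclX _ (schubert_mem w)]
  refine LeadsWith.sum _ _ _ fun p _ => ?_
  have hs : stdDegree p ≠ inv w → stdCoeff (schubert_mem w) p = 0 := fun h =>
    stdCoeff_eq_zero _ _ (homogeneousComponent_schubert w h)
  have hd : stdDegree p ≤ inv w →
      stdCoeff (grothendieck_mem w) p = stdCoeff (schubert_mem w) p := fun h => by
    rw [← sub_eq_zero, ← stdCoeff_sub]
    exact stdCoeff_eq_zero _ _ (homogeneousComponent_grothendieck_sub_schubert w h)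
  have hlead := (LeadsWith.intCast (stdCoeff (grothendieck_mem w) p)).mul (stdMonomial_leadsWith p)
  rw [zero_add] at hlead
  -- Below degree ℓ(w) both coefficients vanish; in degree ℓ(w) they agree; above it the Schubert
  -- coefficient vanishes and the Grothendieck term is of higher order.
  rcases lt_trichotomy (stdDegree p) (inv w) with h | h | h
  · rw [hd h.le, hs h.ne, Int.cast_zero, zero_mul, zero_mul]
    exact LeadsWith.zero _
  · rw [hd h.le, h] at hlead
    rwa [hd h.le]
  · rw [hs h.ne', Int.cast_zero, zero_mul]
    exact hlead.of_lt h

end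

end QGroth

theorem mainTheorem9 :
    (∀ p k : ℕ, p ≤ k →
      QGroth.IsLowestComponent (QGroth.eHat p k) (QGroth.qElem p k) ∧
      QGroth.specQ (QGroth.eHat p k) = QGroth.elem ℤ p k) ∧
    (∀ (n : ℕ) (w : Equiv.Perm (Fin n)),
      QGroth.IsLowestComponent (QGroth.qGrothendieck w) (QGroth.qSchubert w) ∧
      QGroth.specQ (QGroth.qGrothendieck w) = QGroth.grothendieck w) :=
  ⟨fun _ _ h => ⟨(QGroth.eHat_leadsWith h).isLowestComponent (QGroth.qElem_ne_zero h),
      QGroth.specQ_eHat h⟩,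
    fun _ w => ⟨(QGroth.qGrothendieck_leadsWith w).isLowestComponent (QGroth.qSchubert_ne_zero w),
      QGroth.specQ_quantization QGroth.eHat (fun _ _ h => QGroth.specQ_eHat h)
        (QGroth.grothendieck_mem w)⟩⟩
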